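/- Let $\Phi$ be a root system of type $B_n$ or $D_n$ with $n\ge 2$, and let $F=\mathbb F_q$ be a finite field with $q$ elements and characteristic greater than $3$. Index the rows and columns of matrices by $1,\dots,n,0,-n,\dots,-1$ for type $B_n$, and by $1,\dots,n,-n,\dots,-1$ for type $D_n$, and let $e_{a,b}$ be the elementary matrices. Let the positive roots be $\varepsilon_i\pm\varepsilon_j$ for $1\le i<j\le n$ and, for $B_n$ only, $\varepsilon_i$ for $1\le i\le n$, with root vectors $$e_{\varepsilon_i-\varepsilon_j}=e_{i,j}-e_{-j,-i},\qquad e_{\varepsilon_i+\varepsilon_j}=e_{i,-j}-e_{j,-i},\qquad e_{\varepsilon_i}=e_{i,0}-e_{0,-i}.$$ The roots $\varepsilon_i\pm\varepsilon_j$ and $\varepsilon_i$ are said to lie in the $i$th column. Let $\mathfrak{hei}_2(\Phi)$ be the $F$-span of the root vectors of the roots in the first two columns, and let $\mathrm{Hei}_2(\Phi)=\exp\mathfrak{hei}_2(\Phi)$ be the corresponding group of unipotent matrices (the orthogonal $2$-layered Heisenberg group). Then Isaacs' conjecture holds for $\mathrm{Hei}_2(\Phi)$. That is, the degree of every irreducible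 complex character of $\mathrm{Hei}_2(\Phi)$ is a power $q^e$ with $e\ge 0$. Moreover, for every type ($B$ or $D$), every $n\ge 2$ and every $e\ge 0$ there is a polynomial $P_e$ with nonnegative integer coefficients, independent of the field $F$, such that for every finite field $F=\mathbb F_q$ of characteristic greater than $3$ the number of irreducible complex characters of $\mathrm{Hei}_2(\Phi)$ of degree $q^e$ equals $P_e(q-1)$. -/

import Mathlib

namespace OrthHei

/-- The two orthogonal families of classical root systems, `B_n` and `D_n`. -/
inductive OrthType
  | B
  | D

/-- The number of indices `0` among the matrix indices: one for type `B` (matrices of size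
`2n + 1`), none for type `D` (matrices of size `2n`). -/
def OrthType.zeros : OrthType → ℕ
  | .B => 1
  | .D => 0

/-- The matrix indices `1, …, n, (0,) -n, …, -1`. -/
abbrev Idx (Φ : OrthType) (n : ℕ) : Type := Fin n ⊕ Fin Φ.zeros ⊕ Fin n

/-- The matrix index `i` for `1 ≤ i ≤ n` (which is the element `i - 1` of `Fin n`). -/
abbrev Idx.pos {Φ : OrthType} {n : ℕ} (i : Fin n) : Idx Φ n := Sum.inl i

/-- The matrix index `0`, which is present in type `B` only. -/
abbrev Idx.zero {Φ : OrthType} {n : ℕ} (z : Fin Φ.zeros) : Idx Φ n := Sum.inr (Sum.inl z)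

/-- The matrix index `-i` for `1 ≤ i ≤ n`. -/
abbrev Idx.neg {Φ : OrthType} {n : ℕ} (i : Fin n) : Idx Φ n := Sum.inr (Sum.inr i)

/-- The positive roots: `ε_i - ε_j` and `ε_i + ε_j` for `i < j`, and, in type `B` only, `ε_i`. -/
inductive PosRoot (Φ : OrthType) (n : ℕ) : Type
  | sub (i j : Fin n) (h : i < j) : PosRoot Φ n
  | add (i j : Fin n) (h : i < j) : PosRoot Φ n
  | short (z : Fin Φ.zeros) (i : Fin n) : PosRoot Φ n

/-- The column of a positive root: `col (ε_i ± ε_j) = col ε_i = i`. -/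
def PosRoot.col {Φ : OrthType} {n : ℕ} : PosRoot Φ n → Fin n
  | .sub i _ _ => i
  | .add i _ _ => i
  | .short _ i => i

/-- The root vector `e_α` in the orthogonal Lie algebra of the symmetric form
`(u_0 v_0 +) ∑ (u_i v_{-i} + u_{-i} v_i)`:
`e_{i,j} - e_{-j,-i}` for `ε_i - ε_j`, `e_{i,-j} - e_{j,-i}` for `ε_i + ε_j`, and
`e_{i,0} - e_{0,-i}` for `ε_i` (some authors multiply the last one by `√2`, which does not change
the line that it spans). -/
def PosRoot.vec (F : Type*) [Field F] {Φ : OrthType} {n : ℕ} :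
    PosRoot Φ n → Matrix (Idx Φ n) (Idx Φ n) F
  | .sub i j _ =>
      Matrix.single (Idx.pos i) (Idx.pos j) 1 - Matrix.single (Idx.neg j) (Idx.neg i) 1
  | .add i j _ =>
      Matrix.single (Idx.pos i) (Idx.neg j) 1 - Matrix.single (Idx.pos j) (Idx.neg i) 1
  | .short z i =>
      Matrix.single (Idx.pos i) (Idx.zero z) 1 - Matrix.single (Idx.zero z) (Idx.neg i) 1

/-- The space `hei₂(Φ)` spanned by the root vectors of the first two columns
(the elements `0` and `1` of `Fin n`). -/
def heiAlg (Φ : OrthType) (n : ℕ) (F : Type*) [Field F] :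
    Submodule F (Matrix (Idx Φ n) (Idx Φ n) F) :=
  Submodule.span F {X | ∃ α : PosRoot Φ n, (α.col.val = 0 ∨ α.col.val = 1) ∧ X = α.vec F}

/-- The exponential `∑ X ^ k / k!` of a nilpotent matrix, the sum being over the `k` below the
nilpotency class of `X`. It is used below only for `X` with `X ^ 5 = 0` over fields of
characteristic greater than `3`, where all the denominators are invertible. -/
noncomputable def nilExp {ι F : Type*} [Fintype ι] [DecidableEq ι] [Field F]
    (X : Matrix ι ι F) : Matrix ι ι F :=
  ∑ k ∈ Finset.range (nilpotencyClass X), ((k.factorial : F)⁻¹) • X ^ k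

/-- The 2-layered Heisenberg-type group `Hei₂(Φ) = exp hei₂(Φ)`, as a subgroup of the general
linear group. It is given as the subgroup generated by the set `exp hei₂(Φ)`; in characteristic
greater than `3` that set is closed under products and inverses (Baker-Campbell-Hausdorff,
`hei₂(Φ)` being nilpotent of class at most `3`), so the two coincide. -/
noncomputable def heiGroup (Φ : OrthType) (n : ℕ) (F : Type*) [Field F] :
    Subgroup (Matrix.GeneralLinearGroup (Idx Φ n) F) :=
  Subgroup.closure {g | ∃ X ∈ heiAlg Φ n F, (g : Matrix (Idx Φ n) (Idx Φ n) F) = nilExp X}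

/-- The set `Irr(G)` of the characters of the irreducible finite-dimensional complex
representations of `G` (each of which is isomorphic to one on some `ℂ^d`). -/
def irrChar (G : Type*) [Group G] : Set (G → ℂ) :=
  {χ | ∃ (d : ℕ) (ρ : Representation ℂ G (Fin d → ℂ)), ρ.IsIrreducible ∧ χ = ρ.character}

end OrthHei

/-!
`Hei₂(Φ)` is a semidirect product `A ⋊ W` of two abelian groups. With `V` the orthogonal space on
the matrix indices other than `±1` and `±2`, of dimension `N`, the group `A ≅ F × F × V` is the
exponential of the span of the first column (the roots `ε₁ - ε₂`, `ε₁ + ε₂` and those between) and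
`W ≅ V` is the exponential of the span of the second column; `W` acts on `A` by
`(a, c, v) ↦ (a, c + B(v, w) - a B(w, w) / 2, v - a w)` (`OrthHei.exists_splitting`).

For a semidirect product of finite abelian groups, each `W`-orbit of characters of `A` together with
a character of `W` gives a monomial representation on the functions on the orbit, which is
irreducible (`isIrreducible_orbitRep`). Weighted by the inverse orbit sizes, the characters of these
representations add up to the regular character (`sum_orbitChar`), so that, by orthogonality, every
irreducible character `χ` is among them, and arises from exactly `χ(1)²` pairs of a character of `A`
and one of `W` (`card_orbitChar_eq`). Hence the irreducible degrees are the orbit sizes, and the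
number of irreducible characters of degree `d` is `|W| / d²` times the number of characters of `A`
whose orbit has size `d` (`encard_irrChar_mul`).

In coordinates `(α, γ, φ)` on the dual of `A`, the orbit has size `q ^ N` if `γ ≠ 0`, size `q` if
`γ = 0` and `φ ≠ 0`, and size `1` otherwise. So there are `(q - 1) q` irreducible characters of
degree `q ^ N`, `(q ^ N - 1) q ^ (N - 1)` of degree `q` and `q ^ (N + 1)` of degree `1` (numbers to
be added when the degrees coincide), which are polynomials in `q - 1` with nonnegative coefficients
(`charCount`, `irrChar_degrees`).
-/

namespace OrthHei

/-! ### Irreducible characters of a semidirect product of abelian groups -/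

section Splitting

open AddChar

/-- A presentation of a group `G` as a semidirect product `A ⋊ W` of two (additively written)
abelian groups: `toEquiv (a, w)` is the product of the elements `a` and `w`, and `act w` is the
conjugation by `w` on `A`. -/
structure AbelianSplitting (G A W : Type*) [Group G] [AddCommGroup A] [AddCommGroup W] where
  toEquiv : A × W ≃ G
  act : W → A →+ A
  act_zero : act 0 = AddMonoidHom.id A
  act_add : ∀ w w', act (w + w') = (act w).comp (act w')
  map_mul : ∀ a w a' w', toEquiv (a, w) * toEquiv (a', w') = toEquiv (a + act w a', w + w')

namespace AbelianSplitting

variable {G A W : Type*} [Group G] [AddCommGroup A] [AddCommGroup W] (s : AbelianSplitting G A W)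

lemma toEquiv_zero : s.toEquiv (0, 0) = 1 := by
  have h := s.map_mul 0 0 0 0
  simpa using h

lemma symm_one : s.toEquiv.symm 1 = (0, 0) := by
  rw [Equiv.symm_apply_eq, toEquiv_zero]

lemma symm_mul (g h : G) : s.toEquiv.symm (g * h) =
    ((s.toEquiv.symm g).1 + s.act (s.toEquiv.symm g).2 (s.toEquiv.symm h).1,
      (s.toEquiv.symm g).2 + (s.toEquiv.symm h).2) := by
  rw [Equiv.symm_apply_eq, ← s.map_mul]
  simp

/-- The action of `W` on the characters of `A`. -/
def dualAct (w : W) (l : AddChar A ℂ) : AddChar A ℂ := l.compAddMonoidHom (s.act w)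

@[simp] lemma dualAct_apply (w : W) (l : AddChar A ℂ) (a : A) :
    s.dualAct w l a = l (s.act w a) := rfl

@[simp] lemma dualAct_zero (l : AddChar A ℂ) : s.dualAct 0 l = l := by
  ext a
  simp [s.act_zero]

lemma dualAct_dualAct (w w' : W) (l : AddChar A ℂ) :
    s.dualAct w (s.dualAct w' l) = s.dualAct (w' + w) l := by
  ext a
  simp [s.act_add]

/-- The orbit of a character of `A` under `W`. -/
def dualOrbit (l : AddChar A ℂ) : Set (AddChar A ℂ) := Set.range fun w => s.dualAct w l

lemma self_mem_dualOrbit (l : AddChar A ℂ) : l ∈ s.dualOrbit l := ⟨0, by simp⟩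

lemma dualAct_mem_dualOrbit (w : W) {k l : AddChar A ℂ} (h : k ∈ s.dualOrbit l) :
    s.dualAct w k ∈ s.dualOrbit l := by
  obtain ⟨v, rfl⟩ := h
  exact ⟨v + w, (s.dualAct_dualAct w v l).symm⟩

lemma exists_dualAct_eq {k k' l : AddChar A ℂ} (h : k ∈ s.dualOrbit l)
    (h' : k' ∈ s.dualOrbit l) : ∃ w, s.dualAct w k' = k := by
  obtain ⟨v, rfl⟩ := h
  obtain ⟨v', rfl⟩ := h'
  exact ⟨-v' + v, by simp [dualAct_dualAct]⟩

lemma mem_dualOrbit_comm {k l : AddChar A ℂ} : k ∈ s.dualOrbit l ↔ l ∈ s.dualOrbit k := by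
  constructor
  · intro h
    exact s.exists_dualAct_eq (s.self_mem_dualOrbit l) h
  · intro h
    exact s.exists_dualAct_eq (s.self_mem_dualOrbit k) h

lemma dualOrbit_eq_of_mem {k l : AddChar A ℂ} (h : k ∈ s.dualOrbit l) :
    s.dualOrbit k = s.dualOrbit l := by
  obtain ⟨v, rfl⟩ := h
  ext x
  constructor
  · rintro ⟨w, rfl⟩
    exact ⟨v + w, (s.dualAct_dualAct w v l).symm⟩
  · rintro ⟨w, rfl⟩
    exact ⟨-v + w, by simp [dualAct_dualAct]⟩

variable {X : Type*} {l : AddChar A ℂ}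

/-- The monomial representation attached to the orbit of the character `l` of `A` and to a
character `m` of `W`: on functions on the orbit, `A` acts diagonally through the characters in the
orbit, and `W` permutes the coordinates and multiplies by `m`. The orbit is indexed by an arbitrary
type `X`, so that `X = Fin d` is available. -/
def orbitRep (e : X ≃ s.dualOrbit l) (m : AddChar W ℂ) : Representation ℂ G (X → ℂ) where
  toFun g :=
    { toFun f x := (e x).1 (s.toEquiv.symm g).1 * m (s.toEquiv.symm g).2 *
        f (e.symm ⟨s.dualAct (s.toEquiv.symm g).2 (e x).1,
          s.dualAct_mem_dualOrbit _ (e x).2⟩)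
      map_add' f f' := by
        ext x
        simp [mul_add]
      map_smul' c f := by
        ext x
        simp only [Pi.smul_apply, smul_eq_mul, RingHom.id_apply]
        ring }
  map_one' := by
    ext f x
    simp [symm_one]
  map_mul' g h := by
    ext f x
    simp only [symm_mul, LinearMap.coe_mk, AddHom.coe_mk, Module.End.mul_apply,
      Equiv.apply_symm_apply, dualAct_apply, dualAct_dualAct, map_add_eq_mul]
    ring

lemma orbitRep_apply (e : X ≃ s.dualOrbit l) (m : AddChar W ℂ) (g : G) (f : X → ℂ) (x : X) :
    s.orbitRep e m g f x = (e x).1 (s.toEquiv.symm g).1 * m (s.toEquiv.symm g).2 *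
      f (e.symm ⟨s.dualAct (s.toEquiv.symm g).2 (e x).1, s.dualAct_mem_dualOrbit _ (e x).2⟩) :=
  rfl

variable [Finite A]

open Classical in
/-- The character of the monomial representation of the orbit of `l` and of `m`. -/
noncomputable def orbitChar (l : AddChar A ℂ) (m : AddChar W ℂ) (g : G) : ℂ :=
  ∑ k : AddChar A ℂ, if k ∈ s.dualOrbit l ∧ s.dualAct (s.toEquiv.symm g).2 k = k then
    k (s.toEquiv.symm g).1 * m (s.toEquiv.symm g).2 else 0

open Classical in
lemma character_orbitRep [Fintype X] (e : X ≃ s.dualOrbit l) (m : AddChar W ℂ) :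
    (s.orbitRep e m).character = s.orbitChar l m := by
  funext g
  rw [Representation.character, LinearMap.trace_eq_matrix_trace ℂ (Pi.basisFun ℂ X), Matrix.trace,
    orbitChar]
  rw [← Finset.sum_subset (Finset.subset_univ (Finset.univ.filter (· ∈ s.dualOrbit l)))]
  · rw [← Finset.sum_coe_sort (Finset.univ.filter (· ∈ s.dualOrbit l))]
    have h : ∀ k, k ∈ s.dualOrbit l ↔ k ∈ Finset.univ.filter (· ∈ s.dualOrbit l) := by simp
    refine Fintype.sum_equiv (e.trans (Equiv.subtypeEquivRight h)) _ _ fun x => ?_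
    simp only [Matrix.diag_apply, LinearMap.toMatrix_apply, Pi.basisFun_apply, Pi.basisFun_repr,
      orbitRep_apply, Pi.single_apply, Equiv.symm_apply_eq, Equiv.trans_apply,
      Equiv.subtypeEquivRight_apply_coe, Subtype.ext_iff, Subtype.coe_prop, true_and, mul_ite,
      mul_one, mul_zero]
  · intro k _ hk
    simp only [Finset.mem_filter, Finset.mem_univ, true_and] at hk
    simp [hk]

lemma orbitChar_one (l : AddChar A ℂ) (m : AddChar W ℂ) :
    s.orbitChar l m 1 = (s.dualOrbit l).ncard := by
  classical
  simp only [orbitChar, symm_one, dualAct_zero, map_zero_eq_one, mul_one, and_true,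
    Finset.sum_boole, Set.ncard_eq_toFinset_card']
  congr 2
  ext
  simp

open Classical in
/-- Averaging over `A` against the character of index `y` is the projection onto the coordinate `y`,
the characters of the orbit being pairwise distinct. -/
lemma single_mem_of_apply_ne_zero (e : X ≃ s.dualOrbit l) (m : AddChar W ℂ)
    (p : Subrepresentation (s.orbitRep e m)) {f : X → ℂ} (hf : f ∈ p.toSubmodule) {y : X}
    (hy : f y ≠ 0) : Pi.single y (1 : ℂ) ∈ p.toSubmodule := by
  have := Fintype.ofFinite A
  have key : ∑ a : A, (e y).1 (-a) • s.orbitRep e m (s.toEquiv (a, 0)) f =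
      (Fintype.card A * f y) • Pi.single y (1 : ℂ) := by
    ext x
    have h (a : A) : (e y).1 (-a) * (e x).1 a = ((e x).1 - (e y).1) a := by
      rw [sub_apply', map_neg_eq_inv]
      field_simp
    simp only [Finset.sum_apply, Pi.smul_apply, orbitRep_apply, Equiv.symm_apply_apply,
      map_zero_eq_one, dualAct_zero, Subtype.coe_eta, smul_eq_mul, mul_one, ← mul_assoc, h]
    rw [← Finset.sum_mul, sum_eq_ite]
    by_cases hxy : x = y
    · simp [hxy]
    · have : (e x).1 - (e y).1 ≠ 0 := by
        rw [sub_ne_zero]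
        exact fun h => hxy (e.injective (Subtype.ext h))
      simp [hxy, this]
  have hmem : (Fintype.card A * f y) • Pi.single y (1 : ℂ) ∈ p.toSubmodule := by
    rw [← key]
    exact Submodule.sum_mem _ fun a _ =>
      Submodule.smul_mem _ _ (p.apply_mem_toSubmodule _ hf)
  refine (Submodule.smul_mem_iff _ ?_).1 hmem
  exact mul_ne_zero (Nat.cast_ne_zero.2 Fintype.card_ne_zero) hy

/-- A nonzero subrepresentation contains a coordinate vector, since the characters of `A` in the
orbit are pairwise distinct, hence all of them, since `W` is transitive on the orbit. -/
theorem isIrreducible_orbitRep [Finite X] (e : X ≃ s.dualOrbit l) (m : AddChar W ℂ) :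
    (s.orbitRep e m).IsIrreducible := by
  classical
  have := Fintype.ofFinite X
  refine { exists_pair_ne := ⟨⊥, ⊤, fun h => ?_⟩, eq_bot_or_eq_top := fun p => ?_ }
  · have h1 : Pi.single (e.symm ⟨l, s.self_mem_dualOrbit l⟩) (1 : ℂ) ∈
        (⊥ : Subrepresentation (s.orbitRep e m)).toSubmodule := by
      rw [h]
      exact Submodule.mem_top
    have h2 := (Submodule.mem_bot ℂ).1 h1
    simp at h2
  · by_cases hp : ∀ f ∈ p.toSubmodule, f = 0
    · left
      exact Subrepresentation.toSubmodule_injective ((Submodule.eq_bot_iff _).2 hp)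
    right
    push Not at hp
    obtain ⟨f, hf, hf0⟩ := hp
    obtain ⟨y, hy⟩ := Function.ne_iff.1 hf0
    have h1 := s.single_mem_of_apply_ne_zero e m p hf hy
    have h2 (x : X) : Pi.single x (1 : ℂ) ∈ p.toSubmodule := by
      obtain ⟨w, hw⟩ := s.exists_dualAct_eq (e y).2 (e x).2
      refine s.single_mem_of_apply_ne_zero e m p
        (p.apply_mem_toSubmodule (s.toEquiv (0, w)) h1) ?_
      have hy : e.symm ⟨s.dualAct w (e x).1, s.dualAct_mem_dualOrbit w (e x).2⟩ = y := by
        rw [Equiv.symm_apply_eq]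
        exact Subtype.ext hw
      simp only [orbitRep_apply, Equiv.symm_apply_apply, map_zero_eq_one, one_mul, hy,
        Pi.single_eq_same, mul_one]
      intro h
      have h' := m.map_add_eq_mul w (-w)
      simp [h] at h'
    refine Subrepresentation.toSubmodule_injective ((Submodule.eq_top_iff').2 fun f => ?_)
    rw [pi_eq_sum_univ' f]
    refine Submodule.sum_mem _ fun x _ => Submodule.smul_mem _ _ ?_
    convert h2 x using 1

lemma ncard_dualOrbit_pos (l : AddChar A ℂ) : 0 < (s.dualOrbit l).ncard :=
  (Set.ncard_pos (Set.toFinite _)).2 ⟨l, s.self_mem_dualOrbit l⟩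

lemma exists_orbitRep (l : AddChar A ℂ) (m : AddChar W ℂ) :
    ∃ ρ : Representation ℂ G (Fin (s.dualOrbit l).ncard → ℂ),
      ρ.IsIrreducible ∧ ρ.character = s.orbitChar l m := by
  have e : Fin (s.dualOrbit l).ncard ≃ s.dualOrbit l := (Finite.equivFin _).symm
  exact ⟨_, s.isIrreducible_orbitRep e m, s.character_orbitRep e m⟩

lemma orbitChar_mem_irrChar (l : AddChar A ℂ) (m : AddChar W ℂ) :
    s.orbitChar l m ∈ irrChar G := by
  obtain ⟨ρ, h, h'⟩ := s.exists_orbitRep l m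
  exact ⟨_, ρ, h, h'.symm⟩

/-- The characters of the monomial representations, weighted by the inverse orbit sizes, add up to
the character of the regular representation. -/
lemma sum_orbitChar [Fintype G] [DecidableEq G] [Finite W] (g : G) :
    ∑ l : AddChar A ℂ, ∑ m : AddChar W ℂ, ((s.dualOrbit l).ncard : ℂ)⁻¹ * s.orbitChar l m g =
      if g = 1 then (Nat.card G : ℂ) else 0 := by
  classical
  have := Fintype.ofFinite A
  have := Fintype.ofFinite W
  obtain ⟨⟨a, w⟩, rfl⟩ := s.toEquiv.surjective g
  have hW (l : AddChar A ℂ) : ∑ m : AddChar W ℂ,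
      ((s.dualOrbit l).ncard : ℂ)⁻¹ * s.orbitChar l m (s.toEquiv (a, w)) =
      if w = 0 then (Fintype.card W : ℂ) * ∑ k : AddChar A ℂ,
        if k ∈ s.dualOrbit l then ((s.dualOrbit k).ncard : ℂ)⁻¹ * k a else 0 else 0 := by
    rw [← Finset.mul_sum]
    simp only [orbitChar, Equiv.symm_apply_apply]
    rw [Finset.sum_comm]
    have (k : AddChar A ℂ) : ∑ m : AddChar W ℂ,
        (if k ∈ s.dualOrbit l ∧ s.dualAct w k = k then k a * m w else 0) =
        if k ∈ s.dualOrbit l ∧ s.dualAct w k = k then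
          k a * (if w = 0 then (Fintype.card W : ℂ) else 0) else 0 := by
      split_ifs with h1 h2 <;> simp [← Finset.mul_sum, sum_apply_eq_ite, mul_comm, *]
    simp only [this]
    split_ifs with hw
    · subst hw
      simp only [dualAct_zero, and_true, Finset.mul_sum]
      refine Finset.sum_congr rfl fun k _ => ?_
      split_ifs with hk
      · rw [s.dualOrbit_eq_of_mem hk]
        ring
      · simp
    · simp
  simp only [hW]
  have hg : s.toEquiv (a, w) = 1 ↔ a = 0 ∧ w = 0 := by
    rw [← s.toEquiv_zero, s.toEquiv.injective.eq_iff, Prod.mk.injEq]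
  have hcard : (Nat.card G : ℂ) = Fintype.card W * Fintype.card A := by
    rw [← Nat.card_congr s.toEquiv, Nat.card_prod, Nat.card_eq_fintype_card,
      Nat.card_eq_fintype_card]
    push_cast
    ring
  by_cases hw : w = 0
  · subst hw
    simp only [if_true, ← Finset.mul_sum, hg, and_true]
    rw [Finset.sum_comm]
    have (k : AddChar A ℂ) : ∑ l : AddChar A ℂ,
        (if k ∈ s.dualOrbit l then ((s.dualOrbit k).ncard : ℂ)⁻¹ * k a else 0) = k a := by
      rw [← Finset.sum_filter, Finset.sum_const, nsmul_eq_mul]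
      have : (Finset.univ.filter fun l => k ∈ s.dualOrbit l).card = (s.dualOrbit k).ncard := by
        rw [Set.ncard_eq_toFinset_card']
        congr 1
        ext l
        simp [s.mem_dualOrbit_comm (k := k)]
      rw [this]
      have := (s.ncard_dualOrbit_pos k).ne'
      field_simp
    simp only [this, sum_apply_eq_ite, hcard, mul_ite, mul_zero]
  · simp [hw, hg]

lemma degree_ne_zero {d : ℕ} (ρ : Representation ℂ G (Fin d → ℂ)) (hρ : ρ.IsIrreducible) :
    d ≠ 0 := by
  rintro rfl
  obtain ⟨p, q, hpq⟩ := hρ.exists_pair_ne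
  exact hpq (Subrepresentation.toSubmodule_injective (Subsingleton.elim _ _))

open Classical in
/-- An irreducible character `χ` is the character of exactly `χ 1 ^ 2` of the monomial
representations: this is its scalar product with the regular character. -/
theorem card_orbitChar_eq [Finite W] {d : ℕ} (ρ : Representation ℂ G (Fin d → ℂ))
    (hρ : ρ.IsIrreducible) :
    (Finset.univ.filter fun x : AddChar A ℂ × AddChar W ℂ =>
      s.orbitChar x.1 x.2 = ρ.character).card = d ^ 2 := by
  have : Finite G := Finite.of_equiv _ s.toEquiv
  have := Fintype.ofFinite G
  have hG : (Nat.card G : ℂ) ≠ 0 := Nat.cast_ne_zero.2 Nat.card_pos.ne'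
  have : Invertible (Nat.card G : ℂ) := invertibleOfNonzero hG
  have hd : ρ.character 1 = d := by simp
  have horth (l : AddChar A ℂ) (m : AddChar W ℂ) :
      (Nat.card G : ℂ)⁻¹ * ∑ g : G, s.orbitChar l m g * ρ.character g⁻¹ =
        if s.orbitChar l m = ρ.character then 1 else 0 := by
    obtain ⟨σ, hσ, hσ'⟩ := s.exists_orbitRep l m
    have h := Representation.char_orthonormal σ ρ
    rw [← hσ', h]
    refine if_congr ⟨fun ⟨i⟩ => (Representation.char_iso i).symm, fun hi => ?_⟩ rfl rfl
    by_contra hne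
    rw [if_neg hne, hi] at h
    have h' := Representation.char_orthonormal ρ ρ
    rw [h, if_pos ⟨Representation.Equiv.refl ρ⟩] at h'
    exact zero_ne_one h'
  have hsum : ∑ x : AddChar A ℂ × AddChar W ℂ,
      (if s.orbitChar x.1 x.2 = ρ.character then ((s.dualOrbit x.1).ncard : ℂ)⁻¹ else 0) = d := by
    calc _ = ∑ l : AddChar A ℂ, ∑ m : AddChar W ℂ, ((s.dualOrbit l).ncard : ℂ)⁻¹ *
          ((Nat.card G : ℂ)⁻¹ * ∑ g : G, s.orbitChar l m g * ρ.character g⁻¹) := by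
          rw [Fintype.sum_prod_type]
          simp only [horth, mul_ite, mul_one, mul_zero]
      _ = (Nat.card G : ℂ)⁻¹ * ∑ g : G, (∑ l : AddChar A ℂ, ∑ m : AddChar W ℂ,
          ((s.dualOrbit l).ncard : ℂ)⁻¹ * s.orbitChar l m g) * ρ.character g⁻¹ := by
          simp only [Finset.mul_sum, Finset.sum_mul]
          rw [Finset.sum_comm (s := (Finset.univ : Finset G))]
          refine Finset.sum_congr rfl fun l _ => ?_
          rw [Finset.sum_comm]
          refine Finset.sum_congr rfl fun g _ => Finset.sum_congr rfl fun m _ => ?_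
          ring
      _ = d := by
          simp only [s.sum_orbitChar, ite_mul, zero_mul]
          simp
  -- The weight of a pair that gives `ρ` is `d⁻¹`, the size of the orbit being the degree.
  have hterm (x : AddChar A ℂ × AddChar W ℂ) :
      (if s.orbitChar x.1 x.2 = ρ.character then ((s.dualOrbit x.1).ncard : ℂ)⁻¹ else 0) =
        if s.orbitChar x.1 x.2 = ρ.character then (d : ℂ)⁻¹ else 0 := by
    refine ite_congr rfl (fun h => ?_) fun _ => rfl
    rw [← s.orbitChar_one x.1 x.2, h, hd]
  simp only [hterm] at hsum
  rw [← Finset.sum_filter, Finset.sum_const, nsmul_eq_mul] at hsum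
  have hd0 : (d : ℂ) ≠ 0 := by
    exact Nat.cast_ne_zero.2 (degree_ne_zero ρ hρ)
  rw [← div_eq_mul_inv, div_eq_iff hd0, ← pow_two] at hsum
  convert (Nat.cast_injective (R := ℂ) (hsum.trans (Nat.cast_pow d 2).symm))

lemma exists_orbitChar_eq [Finite W] {χ : G → ℂ} (hχ : χ ∈ irrChar G) :
    ∃ l m, s.orbitChar l m = χ := by
  classical
  obtain ⟨d, ρ, hρ, rfl⟩ := hχ
  have h := s.card_orbitChar_eq ρ hρ
  have hpos : 0 < d ^ 2 := pow_pos (Nat.pos_of_ne_zero (degree_ne_zero ρ hρ)) 2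
  rw [← h, Finset.card_pos] at hpos
  obtain ⟨x, hx⟩ := hpos
  exact ⟨x.1, x.2, (Finset.mem_filter.1 hx).2⟩

/-- Every irreducible degree of `A ⋊ W` is the size of an orbit of `W` on the characters of `A`. -/
theorem exists_ncard_dualOrbit_eq [Finite W] {χ : G → ℂ} (hχ : χ ∈ irrChar G) :
    ∃ l : AddChar A ℂ, χ 1 = (s.dualOrbit l).ncard := by
  obtain ⟨l, m, rfl⟩ := s.exists_orbitChar_eq hχ
  exact ⟨l, s.orbitChar_one l m⟩

/-- The number `c` of irreducible characters of degree `d`, in terms of the orbits of size `d`. -/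
theorem encard_irrChar_mul [Finite W] (d : ℕ) : ∃ c : ℕ,
    {χ ∈ irrChar G | χ 1 = d}.encard = c ∧
      d ^ 2 * c = Nat.card W * Nat.card {l : AddChar A ℂ // (s.dualOrbit l).ncard = d} := by
  classical
  have := Fintype.ofFinite W
  let S : Finset (AddChar A ℂ × AddChar W ℂ) :=
    Finset.univ.filter fun x => (s.dualOrbit x.1).ncard = d
  let T : Finset (G → ℂ) := S.image fun x => s.orbitChar x.1 x.2
  have hT : {χ ∈ irrChar G | χ 1 = d} = (T : Set (G → ℂ)) := by
    ext χ
    simp only [Set.mem_ofPred_eq, T, S, Finset.coe_image, Finset.coe_filter, Finset.mem_univ,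
      true_and, Set.mem_image, Prod.exists]
    constructor
    · rintro ⟨hχ, h1⟩
      obtain ⟨l, m, rfl⟩ := s.exists_orbitChar_eq hχ
      rw [orbitChar_one, Nat.cast_inj] at h1
      exact ⟨l, m, h1, rfl⟩
    · rintro ⟨l, m, h1, rfl⟩
      exact ⟨s.orbitChar_mem_irrChar l m, by rw [orbitChar_one, h1]⟩
  refine ⟨T.card, by rw [hT, Set.encard_coe_eq_coe_finsetCard], ?_⟩
  have hfib : ∀ χ ∈ T, (S.filter fun x => s.orbitChar x.1 x.2 = χ).card = d ^ 2 := by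
    intro χ hχ
    have h1 : χ ∈ irrChar G ∧ χ 1 = d := by
      have : χ ∈ (T : Set (G → ℂ)) := hχ
      rwa [← hT] at this
    obtain ⟨⟨d', ρ, hρ, rfl⟩, hd⟩ := h1
    have hd' : d' = d := by simpa using hd
    rw [← hd', ← s.card_orbitChar_eq ρ hρ]
    congr 1
    ext x
    simp only [S, Finset.mem_filter, Finset.mem_univ, true_and, and_iff_right_iff_imp]
    intro hx
    rw [← hx, orbitChar_one, Nat.cast_inj] at hd
    exact hd
  have hS : S.card = Nat.card W * Nat.card {l : AddChar A ℂ // (s.dualOrbit l).ncard = d} := by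
    have : S = (Finset.univ.filter fun l : AddChar A ℂ => (s.dualOrbit l).ncard = d) ×ˢ
        (Finset.univ : Finset (AddChar W ℂ)) := by
      ext x
      simp [S]
    rw [this, Finset.card_product, Finset.card_univ, card_eq, Nat.card_eq_fintype_card,
      Nat.card_eq_fintype_card, Fintype.card_subtype, mul_comm]
  rw [← hS, Finset.card_eq_sum_card_image (fun x => s.orbitChar x.1 x.2) S,
    Finset.sum_congr rfl hfib, Finset.sum_const, smul_eq_mul, mul_comm]

end AbelianSplitting

end Splitting

/-! ### The orbits on the characters of the first column -/

section Orbits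

open AddChar

section
variable {F K : Type*} [Field F] [Fintype K]

/-- The action of `W = K → F` (the second column) on `A = F × F × (K → F)` (the span of the root
vectors of `ε₁ - ε₂`, of `ε₁ + ε₂` and of the rest of the first column) by conjugation. The
symmetric form on `K → F` is `(v, w) ↦ v ⬝ᵥ (w ∘ ν)`, for the involution `ν` of `K` that changes
the sign of an index. -/
def heiAct (ν : K → K) (w : K → F) : F × F × (K → F) →+ F × F × (K → F) where
  toFun x := (x.1, x.2.1 + x.2.2 ⬝ᵥ (w ∘ ν) - x.1 * (w ⬝ᵥ (w ∘ ν)) / 2, x.2.2 - x.1 • w)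
  map_zero' := by simp
  map_add' x y := by
    refine Prod.ext rfl (Prod.ext ?_ ?_)
    · simp only [Prod.fst_add, Prod.snd_add, add_dotProduct]
      ring
    · simp only [Prod.fst_add, Prod.snd_add, add_smul]
      abel

lemma heiAct_apply (ν : K → K) (w : K → F) (x : F × F × (K → F)) : heiAct ν w x =
    (x.1, x.2.1 + x.2.2 ⬝ᵥ (w ∘ ν) - x.1 * (w ⬝ᵥ (w ∘ ν)) / 2, x.2.2 - x.1 • w) := rfl

lemma dotProduct_comp_comm {ν : K → K} (hν : Function.Involutive ν) (v w : K → F) :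
    v ⬝ᵥ (w ∘ ν) = w ⬝ᵥ (v ∘ ν) := by
  rw [← comp_equiv_dotProduct_comp_equiv v (w ∘ ν) hν.toPerm, dotProduct_comm]
  congr 1
  ext k
  simp [hν k]

lemma heiAct_zero (ν : K → K) : heiAct ν (0 : K → F) = AddMonoidHom.id _ := by
  ext x : 1
  simp [heiAct_apply, show (0 : K → F) ∘ ν = 0 from rfl]

lemma heiAct_add {ν : K → K} (hν : Function.Involutive ν) (h2 : (2 : F) ≠ 0) (w w' : K → F) :
    heiAct ν (w + w') = (heiAct ν w).comp (heiAct ν w') := by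
  ext x : 1
  have h : (w + w') ∘ ν = w ∘ ν + w' ∘ ν := rfl
  simp only [AddMonoidHom.comp_apply, heiAct_apply, h, dotProduct_add, add_dotProduct,
    sub_dotProduct, smul_dotProduct, smul_add, smul_eq_mul, dotProduct_comp_comm hν w w']
  refine Prod.ext rfl (Prod.ext ?_ ?_)
  · field_simp
    ring
  · simp only
    abel

/-- The character of `F × F × (K → F)` with coordinates `d`, for a fixed character `ψ` of `F`. -/
def dualPoint (ψ : AddChar F ℂ) (d : F × F × (K → F)) : AddChar (F × F × (K → F)) ℂ where
  toFun x := ψ (d.1 * x.1 + d.2.1 * x.2.1 + d.2.2 ⬝ᵥ x.2.2)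
  map_zero_eq_one' := by simp
  map_add_eq_mul' x y := by
    rw [← map_add_eq_mul]
    congr 1
    simp only [Prod.fst_add, Prod.snd_add, dotProduct_add]
    ring

lemma dualPoint_apply (ψ : AddChar F ℂ) (d x : F × F × (K → F)) :
    dualPoint ψ d x = ψ (d.1 * x.1 + d.2.1 * x.2.1 + d.2.2 ⬝ᵥ x.2.2) := rfl

lemma dualPoint_injective {ψ : AddChar F ℂ} (hψ : ψ.IsPrimitive) :
    Function.Injective (dualPoint ψ : F × F × (K → F) → _) := by
  classical
  have key {a b : F} (h : ∀ t, ψ (a * t) = ψ (b * t)) : a = b :=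
    to_mulShift_inj_of_isPrimitive hψ (by ext t; simpa using h t)
  intro d d' h
  have h1 (x : F × F × (K → F)) := DFunLike.congr_fun h x
  simp only [dualPoint_apply] at h1
  refine Prod.ext ?_ (Prod.ext ?_ (funext fun k => ?_))
  · exact key fun t => by simpa using h1 (t, 0, 0)
  · exact key fun t => by simpa using h1 (0, t, 0)
  · exact key fun t => by simpa using h1 (0, 0, Pi.single k t)

lemma dualPoint_bijective [Finite F] {ψ : AddChar F ℂ} (hψ : ψ.IsPrimitive) :
    Function.Bijective (dualPoint ψ : F × F × (K → F) → _) := by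
  classical
  have := Fintype.ofFinite F
  rw [Fintype.bijective_iff_injective_and_card]
  exact ⟨dualPoint_injective hψ, card_eq.symm⟩

lemma dualPoint_heiAct (ν : K → K) (ψ : AddChar F ℂ) (w : K → F) (d : F × F × (K → F)) :
    (dualPoint ψ d).compAddMonoidHom (heiAct ν w) =
      dualPoint ψ (d.1 - d.2.1 * (w ⬝ᵥ (w ∘ ν)) / 2 - d.2.2 ⬝ᵥ w, d.2.1,
        d.2.2 + d.2.1 • (w ∘ ν)) := by
  ext x
  simp only [compAddMonoidHom_apply, dualPoint_apply, heiAct_apply]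
  congr 1
  simp only [dotProduct_sub, dotProduct_smul, add_dotProduct, smul_dotProduct, smul_eq_mul,
    dotProduct_comm (w ∘ ν) x.2.2]
  ring

lemma exists_isPrimitive (F : Type*) [Field F] [Finite F] :
    ∃ ψ : AddChar F ℂ, ψ.IsPrimitive := by
  obtain ⟨ψ, hψ⟩ := (exists_apply_ne_zero (α := F) (a := 1)).2 one_ne_zero
  exact ⟨ψ, IsPrimitive.of_ne_one fun h => hψ (by rw [h, one_apply])⟩

end

section Count

variable {F K G : Type*} [Field F] [Fintype K] [Group G]
  (s : AbelianSplitting G (F × F × (K → F)) (K → F)) {ν : K → K} (hν : Function.Involutive ν)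
  (hs : s.act = heiAct ν) {ψ : AddChar F ℂ} (hψ : ψ.IsPrimitive)

include hs in
lemma dualOrbit_dualPoint (d : F × F × (K → F)) : s.dualOrbit (dualPoint ψ d) =
    Set.range fun w : K → F => dualPoint ψ (d.1 - d.2.1 * (w ⬝ᵥ (w ∘ ν)) / 2 - d.2.2 ⬝ᵥ w, d.2.1,
        d.2.2 + d.2.1 • (w ∘ ν)) := by
  simp only [AbelianSplitting.dualOrbit, AbelianSplitting.dualAct, hs, dualPoint_heiAct]

include hν hs hψ in
/-- A character that is nontrivial on the center (`d.2.1 ≠ 0`) has trivial stabilizer. -/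
lemma ncard_dualOrbit_of_ne_zero {d : F × F × (K → F)} (hd : d.2.1 ≠ 0) :
    (s.dualOrbit (dualPoint ψ d)).ncard = Nat.card F ^ Fintype.card K := by
  rw [dualOrbit_dualPoint s hs, ← Set.image_univ, Set.ncard_image_of_injective, Set.ncard_univ,
    Nat.card_fun, Nat.card_eq_fintype_card (α := K)]
  intro w w' h
  have h1 := congrArg (fun d => d.2.2) (dualPoint_injective hψ h)
  have h2 := smul_right_injective _ hd (add_left_cancel h1)
  exact hν.surjective.injective_comp_right h2

include hs hψ in
/-- A character that is trivial on the center, but not on the rest of the first column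
(`d.2.2 ≠ 0`), has for its orbit a line in the direction of the root `ε₁ - ε₂`. -/
lemma ncard_dualOrbit_of_eq_zero_of_ne_zero {d : F × F × (K → F)} (hd : d.2.1 = 0)
    (hd' : d.2.2 ≠ 0) : (s.dualOrbit (dualPoint ψ d)).ncard = Nat.card F := by
  classical
  have h : s.dualOrbit (dualPoint ψ d) = Set.range fun t : F => dualPoint ψ (t, 0, d.2.2) := by
    rw [dualOrbit_dualPoint s hs]
    simp only [hd, zero_mul, zero_div, sub_zero, zero_smul, add_zero]
    refine Set.Subset.antisymm ?_ ?_
    · rintro _ ⟨w, rfl⟩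
      exact ⟨_, rfl⟩
    · rintro _ ⟨t, rfl⟩
      obtain ⟨k, hk⟩ := Function.ne_iff.1 hd'
      refine ⟨Pi.single k ((d.1 - t) / d.2.2 k), ?_⟩
      have hk' : d.2.2 k ≠ 0 := hk
      simp only [dotProduct_single]
      congr 2
      field_simp
      ring
  rw [h, ← Set.image_univ, Set.ncard_image_of_injective, Set.ncard_univ]
  intro t t' h
  exact congrArg Prod.fst (dualPoint_injective hψ h)

include hs in
lemma ncard_dualOrbit_of_eq_zero {d : F × F × (K → F)} (hd : d.2.1 = 0) (hd' : d.2.2 = 0) :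
    (s.dualOrbit (dualPoint ψ d)).ncard = 1 := by
  rw [dualOrbit_dualPoint s hs]
  simp [hd, hd']

lemma sum_ite_eq_add {α : Type*} [Fintype α] [DecidableEq α] (z : α) (a b : ℕ) :
    ∑ x : α, (if x = z then b else a) = b + (Fintype.card α - 1) * a := by
  rw [Finset.sum_ite, Finset.filter_eq' Finset.univ z, Finset.filter_ne' Finset.univ z]
  simp

variable [Finite F]

include hν hs in
/-- The number of characters of `A` whose orbit has a given size. The cases are added because the
three orbit sizes may coincide (when `K` has at most one element). -/
lemma card_dualOrbit_eq (D : ℕ) :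
    Nat.card {l : AddChar (F × F × (K → F)) ℂ // (s.dualOrbit l).ncard = D} =
      Nat.card F * ((if Nat.card F ^ Fintype.card K = D then
          (Nat.card F - 1) * Nat.card F ^ Fintype.card K else 0) +
        (if Nat.card F = D then Nat.card F ^ Fintype.card K - 1 else 0) +
        if 1 = D then 1 else 0) := by
  classical
  have := Fintype.ofFinite F
  obtain ⟨ψ, hψ⟩ := exists_isPrimitive F
  have hsize (d : F × F × (K → F)) : (s.dualOrbit (dualPoint ψ d)).ncard =
      if d.2.1 = 0 then (if d.2.2 = 0 then 1 else Nat.card F)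
      else Nat.card F ^ Fintype.card K := by
    split_ifs with h1 h2
    · exact ncard_dualOrbit_of_eq_zero s hs h1 h2
    · exact ncard_dualOrbit_of_eq_zero_of_ne_zero s hs hψ h1 h2
    · exact ncard_dualOrbit_of_ne_zero s hν hs hψ h1
  rw [← Nat.card_congr ((Equiv.ofBijective _ (dualPoint_bijective hψ)).subtypeEquiv
    (p := fun d => (s.dualOrbit (dualPoint ψ d)).ncard = D) fun d => Iff.rfl),
    Nat.card_eq_fintype_card, Fintype.card_subtype, Finset.card_filter]
  simp only [hsize, Fintype.sum_prod_type]
  have hcard : Fintype.card (K → F) = Nat.card F ^ Fintype.card K := by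
    rw [Fintype.card_fun, Nat.card_eq_fintype_card]
  have h1 (γ : F) : ∑ φ : K → F, (if (if γ = 0 then (if φ = 0 then 1 else Nat.card F)
      else Nat.card F ^ Fintype.card K) = D then 1 else 0) =
      if γ = 0 then ((if 1 = D then 1 else 0) +
        if Nat.card F = D then Nat.card F ^ Fintype.card K - 1 else 0) else
        if Nat.card F ^ Fintype.card K = D then Nat.card F ^ Fintype.card K else 0 := by
    by_cases hγ : γ = 0
    · simp only [hγ, if_true, apply_ite (· = D), ite_prop_iff_or]
      have (φ : K → F) : (if (φ = 0 ∧ 1 = D ∨ ¬φ = 0 ∧ Nat.card F = D) then 1 else 0) =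
          if φ = 0 then (if 1 = D then 1 else 0) else if Nat.card F = D then 1 else 0 := by
        by_cases h : φ = 0 <;> simp [h]
      simp only [this, sum_ite_eq_add, hcard, mul_ite, mul_one, mul_zero]
    · simp only [hγ, if_false, Finset.sum_const, Finset.card_univ, hcard, smul_eq_mul, mul_ite,
        mul_one, mul_zero]
  simp only [h1, sum_ite_eq_add, Finset.sum_const, smul_eq_mul, Finset.card_univ]
  rw [← Nat.card_eq_fintype_card (α := F), mul_ite, mul_zero]
  ring

/-- The polynomial that, at `q - 1`, counts the irreducible characters of degree `q ^ e`, where `N`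
is the number of roots of the second column. For `N = 0` the middle term vanishes, its sum being
empty, so that the truncated exponent `N - 1` does not matter. -/
noncomputable def charCount (N e : ℕ) : Polynomial ℕ :=
  (if e = N then Polynomial.X * (Polynomial.X + 1) else 0) +
  (if e = 1 then Polynomial.X * (∑ i ∈ Finset.range N, (Polynomial.X + 1) ^ i) *
    (Polynomial.X + 1) ^ (N - 1) else 0) +
  if e = 0 then (Polynomial.X + 1) ^ (N + 1) else 0

lemma eval_charCount (N e v : ℕ) : (charCount N e).eval v = (if e = N then v * (v + 1) else 0) +
    (if e = 1 then ((v + 1) ^ N - 1) * (v + 1) ^ (N - 1) else 0) +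
    if e = 0 then (v + 1) ^ (N + 1) else 0 := by
  have h : v * ∑ i ∈ Finset.range N, (v + 1) ^ i = (v + 1) ^ N - 1 := by
    have := geom_sum_mul_add v N
    rw [mul_comm]
    omega
  rw [← h, charCount]
  simp only [Polynomial.eval_add, apply_ite (Polynomial.eval v), Polynomial.eval_mul,
    Polynomial.eval_pow, Polynomial.eval_X, Polynomial.eval_one, Polynomial.eval_finsetSum,
    Polynomial.eval_zero]

include hν hs in
/-- The degrees of the irreducible characters of `A ⋊ W` for the action `heiAct`, and the number of
characters of each degree. -/
theorem irrChar_degrees :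
    (∀ χ ∈ irrChar G, ∃ e : ℕ, χ 1 = (Nat.card F : ℂ) ^ e) ∧
      ∀ e : ℕ, {χ ∈ irrChar G | χ 1 = (Nat.card F : ℂ) ^ e}.encard =
        (((charCount (Fintype.card K) e).eval (Nat.card F - 1) : ℕ) : ℕ∞) := by
  have hq : 1 < Nat.card F := Finite.one_lt_card
  constructor
  · intro χ hχ
    obtain ⟨l, hl⟩ := s.exists_ncard_dualOrbit_eq hχ
    obtain ⟨ψ, hψ⟩ := exists_isPrimitive F
    obtain ⟨d, rfl⟩ := (dualPoint_bijective hψ).surjective l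
    rw [hl]
    by_cases h1 : d.2.1 = 0
    · by_cases h2 : d.2.2 = 0
      · exact ⟨0, by simp [ncard_dualOrbit_of_eq_zero s hs h1 h2]⟩
      · exact ⟨1, by simp [ncard_dualOrbit_of_eq_zero_of_ne_zero s hs hψ h1 h2]⟩
    · exact ⟨Fintype.card K, by simp [ncard_dualOrbit_of_ne_zero s hν hs hψ h1]⟩
  · intro e
    obtain ⟨c, hc, hc'⟩ := s.encard_irrChar_mul (Nat.card F ^ e)
    rw [Nat.cast_pow] at hc
    rw [hc, Nat.cast_inj, eval_charCount]
    rw [card_dualOrbit_eq s hν hs, Nat.card_fun, Nat.card_eq_fintype_card (α := K)] at hc'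
    generalize Fintype.card K = N at *
    obtain ⟨v, hv⟩ : ∃ v, Nat.card F = v + 1 := ⟨Nat.card F - 1, by omega⟩
    rw [hv] at hc' hq ⊢
    rw [Nat.add_sub_cancel] at hc' ⊢
    have h1 : (v + 1) ^ N = (v + 1) ^ e ↔ e = N := by
      rw [Nat.pow_right_inj hq, eq_comm]
    have h2 : v + 1 = (v + 1) ^ e ↔ e = 1 := by
      conv_lhs => lhs; rw [← pow_one (v + 1)]
      rw [Nat.pow_right_inj hq, eq_comm]
    have h3 : 1 = (v + 1) ^ e ↔ e = 0 := by
      conv_lhs => lhs; rw [← pow_zero (v + 1)]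
      rw [Nat.pow_right_inj hq, eq_comm]
    simp only [h1, h2, h3] at hc'
    have hpos : 0 < ((v + 1) ^ e) ^ 2 := by positivity
    refine Nat.eq_of_mul_eq_mul_left hpos (hc'.trans ?_)
    simp only [mul_add]
    congr 1
    · congr 1
      · split_ifs with h
        · rw [h]; ring
        · simp
      · split_ifs with h
        · subst h
          cases N with
          | zero => simp
          | succ N => rw [Nat.add_sub_cancel]; ring
        · simp
    · split_ifs with h
      · rw [h]; ring
      · simp

end Count

end Orbits

/-! ### Exponentials in the span of the first two columns -/

lemma nilExp_eq_sum_range {ι F : Type*} [Fintype ι] [DecidableEq ι] [Field F]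
    {X : Matrix ι ι F} {N : ℕ} (h : X ^ N = 0) :
    nilExp X = ∑ k ∈ Finset.range N, ((k.factorial : F)⁻¹) • X ^ k := by
  refine Finset.sum_subset (Finset.range_subset_range.2 (Nat.sInf_le h)) fun k _ hk => ?_
  rw [Finset.mem_range, not_lt] at hk
  rw [pow_eq_zero_of_le hk (pow_nilpotencyClass ⟨N, h⟩), smul_zero]

/-- The block structure of the matrices of the first two columns, as relations in an algebra `R`:
`e`, `f`, `s` play the roles of `e_{1,2}`, `e_{-2,-1}`, `e_{2,-2}`, and `r v` and `k v` those of the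
row `∑ v_j e_{2,j}` and of the column `∑ v_j e_{-j,-2}`, the sums being over the indices `j`
other than `±1` and `±2`. -/
structure BlockFrame (F K R : Type*) [Field F] [Fintype K] [Ring R] [Algebra F R] (ν : K → K) where
  e : R
  f : R
  s : R
  r : (K → F) →ₗ[F] R
  k : (K → F) →ₗ[F] R
  ee : e * e = 0
  ef : e * f = 0
  ek : ∀ v, e * k v = 0
  fe : f * e = 0
  ff : f * f = 0
  fs : f * s = 0
  fr : ∀ v, f * r v = 0
  fk : ∀ v, f * k v = 0
  se : s * e = 0
  ss : s * s = 0
  sr : ∀ v, s * r v = 0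
  sk : ∀ v, s * k v = 0
  re : ∀ v, r v * e = 0
  rf : ∀ v, r v * f = 0
  rs : ∀ v, r v * s = 0
  rr : ∀ v w, r v * r w = 0
  ke : ∀ v, k v * e = 0
  ks : ∀ v, k v * s = 0
  kr : ∀ v w, k v * r w = 0
  kk : ∀ v w, k v * k w = 0
  rk : ∀ v w, r v * k w = (v ⬝ᵥ (w ∘ ν)) • s

namespace BlockFrame

variable {F K R : Type*} [Field F] [Fintype K] [Ring R] [Algebra F R] {ν : K → K}
  (b : BlockFrame F K R ν)

-- The same relations inside a product that is associated to the right, for use by `simp`.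

lemma ee' (x : R) : b.e * (b.e * x) = 0 := by rw [← mul_assoc, b.ee, zero_mul]
lemma ef' (x : R) : b.e * (b.f * x) = 0 := by rw [← mul_assoc, b.ef, zero_mul]
lemma ek' (v) (x : R) : b.e * (b.k v * x) = 0 := by rw [← mul_assoc, b.ek, zero_mul]
lemma fe' (x : R) : b.f * (b.e * x) = 0 := by rw [← mul_assoc, b.fe, zero_mul]
lemma fs' (x : R) : b.f * (b.s * x) = 0 := by rw [← mul_assoc, b.fs, zero_mul]
lemma fk' (v) (x : R) : b.f * (b.k v * x) = 0 := by rw [← mul_assoc, b.fk, zero_mul]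
lemma se' (x : R) : b.s * (b.e * x) = 0 := by rw [← mul_assoc, b.se, zero_mul]
lemma ss' (x : R) : b.s * (b.s * x) = 0 := by rw [← mul_assoc, b.ss, zero_mul]
lemma sk' (v) (x : R) : b.s * (b.k v * x) = 0 := by rw [← mul_assoc, b.sk, zero_mul]
lemma re' (v) (x : R) : b.r v * (b.e * x) = 0 := by rw [← mul_assoc, b.re, zero_mul]
lemma rs' (v) (x : R) : b.r v * (b.s * x) = 0 := by rw [← mul_assoc, b.rs, zero_mul]
lemma ke' (v) (x : R) : b.k v * (b.e * x) = 0 := by rw [← mul_assoc, b.ke, zero_mul]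
lemma ks' (v) (x : R) : b.k v * (b.s * x) = 0 := by rw [← mul_assoc, b.ks, zero_mul]
lemma kk' (v w) (x : R) : b.k v * (b.k w * x) = 0 := by rw [← mul_assoc, b.kk, zero_mul]
lemma rk' (v w) (x : R) : b.r v * (b.k w * x) = (v ⬝ᵥ (w ∘ ν)) • (b.s * x) := by
  rw [← mul_assoc, b.rk, smul_mul_assoc]

attribute [simp] ee ef ek fe ff fs fr fk se ss sr sk re rf rs rr ke ks kr kk rk

attribute [simp] ee' ef' ek' fe' fs' fk' se' ss' sk' re' rs' ke' ks' kk' rk'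

/-- The general element of the span of the root vectors of the first two columns: `x.1`, `x.2.1`,
`x.2.2` and `w` are the coordinates on `ε₁ - ε₂`, on `ε₁ + ε₂`, on the other roots of the first
column, and on the roots of the second column. -/
def elt (x : F × F × (K → F)) (w : K → F) : R :=
  x.1 • (b.e - b.f) + x.2.1 • (b.e * b.s - b.s * b.f) +
    (b.e * b.r x.2.2 - b.k x.2.2 * b.f) + (b.r w - b.k w)

/-- The exponential of the element `b.elt x 0` of the span of the first column, whose cube is
`0`. -/
def expA (x : F × F × (K → F)) : R :=
  1 + b.elt x 0 - (x.1 * x.2.1 + x.2.2 ⬝ᵥ (x.2.2 ∘ ν) / 2) • (b.e * (b.s * b.f))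

/-- The exponential of the element `b.elt 0 w` of the span of the second column. -/
def expW (w : K → F) : R := 1 + (b.r w - b.k w) - (w ⬝ᵥ (w ∘ ν) / 2) • b.s

lemma expA_zero : b.expA 0 = 1 := by simp [expA, elt]

lemma expW_zero : b.expW 0 = 1 := by simp [expW]

/-- The expansion in which the entries of the first two rows are visible. -/
lemma expA_mul_expW (a c : F) (v w : K → F) :
    b.expA (a, c, v) * b.expW w = 1 + a • (b.e - b.f) + (b.r w - b.k w) +
      b.e * b.r (v + a • w) - b.k v * b.f +
      (c - v ⬝ᵥ (w ∘ ν) - a * (w ⬝ᵥ (w ∘ ν)) / 2) • (b.e * b.s) - c • (b.s * b.f)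
      - (w ⬝ᵥ (w ∘ ν) / 2) • b.s
      - (a * c + v ⬝ᵥ (v ∘ ν) / 2) • (b.e * (b.s * b.f)) := by
  simp [expW, expA, elt, mul_add, add_mul, mul_sub, sub_mul, mul_assoc]
  match_scalars <;> ring

variable (hν : Function.Involutive ν) (h2 : (2 : F) ≠ 0)

include hν h2 in
lemma expA_mul_expA (x y : F × F × (K → F)) : b.expA x * b.expA y = b.expA (x + y) := by
  obtain ⟨a, c, v⟩ := x
  obtain ⟨a', c', v'⟩ := y
  simp [expA, elt, mul_add, add_mul, mul_sub, sub_mul, mul_assoc,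
    show (v + v') ∘ ν = v ∘ ν + v' ∘ ν from rfl, add_dotProduct, dotProduct_add,
    dotProduct_comp_comm hν v' v]
  match_scalars <;> field_simp <;> ring

include hν h2 in
lemma expW_mul_expW (w w' : K → F) : b.expW w * b.expW w' = b.expW (w + w') := by
  simp [expW, mul_add, add_mul, mul_sub, sub_mul, show (w + w') ∘ ν = w ∘ ν + w' ∘ ν from rfl,
    add_dotProduct, dotProduct_add,
    dotProduct_comp_comm hν w' w]
  match_scalars <;> field_simp
  ring

include hν h2 in
lemma expW_mul_expA (w : K → F) (x : F × F × (K → F)) :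
    b.expW w * b.expA x = b.expA (heiAct ν w x) * b.expW w := by
  obtain ⟨a, c, v⟩ := x
  simp [expW, expA, elt, heiAct_apply, mul_add, add_mul, mul_sub, sub_mul, mul_assoc,
    show (v - a • w) ∘ ν = v ∘ ν - a • (w ∘ ν) from rfl, sub_dotProduct, dotProduct_sub,
    smul_dotProduct, dotProduct_smul, dotProduct_comp_comm hν w v]
  match_scalars <;> field_simp <;> ring

include hν in
lemma elt_sq (a c : F) (v w : K → F) : b.elt (a, c, v) w * b.elt (a, c, v) w =
    a • (b.e * b.r w) + a • (b.k w * b.f)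
      - (2 * (a * c) + v ⬝ᵥ (v ∘ ν)) • (b.e * (b.s * b.f))
      - (v ⬝ᵥ (w ∘ ν)) • (b.e * b.s + b.s * b.f) - (w ⬝ᵥ (w ∘ ν)) • b.s := by
  simp [elt, mul_add, add_mul, mul_sub, sub_mul, mul_assoc, dotProduct_comp_comm hν w v]
  match_scalars <;> ring

include hν in
lemma elt_cube (a c : F) (v w : K → F) : b.elt (a, c, v) w ^ 3 =
    (a * (w ⬝ᵥ (w ∘ ν))) • (b.s * b.f - b.e * b.s) := by
  rw [pow_succ', pow_two, elt_sq b hν]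
  simp [elt, mul_add, add_mul, mul_sub, sub_mul, mul_assoc]
  match_scalars <;> ring

include hν in
lemma elt_pow_four (a c : F) (v w : K → F) : b.elt (a, c, v) w ^ 4 =
    (a ^ 2 * (w ⬝ᵥ (w ∘ ν))) • (b.e * (b.s * b.f)) := by
  rw [pow_succ', elt_cube b hν]
  simp [elt, add_mul, mul_sub, sub_mul, mul_assoc]
  match_scalars
  ring

include hν in
lemma elt_pow_five (x : F × F × (K → F)) (w : K → F) : b.elt x w ^ 5 = 0 := by
  obtain ⟨a, c, v⟩ := x
  rw [pow_succ', elt_pow_four b hν]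
  simp [elt, add_mul, sub_mul, mul_assoc]

include hν h2 in
/-- The exponential of a sum of elements of the abelian ideal `A` and of the abelian subalgebra
`W`: by Baker-Campbell-Hausdorff its component in `A` is `((exp (ad w) - 1) / ad w) x`. -/
lemma sum_elt_pow (h3 : (3 : F) ≠ 0) (a c : F) (v w : K → F) :
    ∑ i ∈ Finset.range 5, ((i.factorial : F)⁻¹) • b.elt (a, c, v) w ^ i =
      b.expA (a, c + v ⬝ᵥ (w ∘ ν) / 2 - a * (w ⬝ᵥ (w ∘ ν)) / 6, v - (a / 2) • w) * b.expW w := by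
  have h6 : (6 : F) ≠ 0 := by
    rw [show (6 : F) = 2 * 3 by norm_num]
    exact mul_ne_zero h2 h3
  have h24 : (24 : F) ≠ 0 := by
    rw [show (24 : F) = 2 * 2 * 6 by norm_num]
    exact mul_ne_zero (mul_ne_zero h2 h2) h6
  simp only [Finset.sum_range_succ, Finset.sum_range_zero, pow_zero, pow_one, elt_cube b hν,
    elt_pow_four b hν, pow_two (b.elt _ _), elt_sq b hν, Nat.factorial, Nat.cast_ofNat,
    Nat.cast_one, Nat.succ_eq_add_one, Nat.reduceAdd, Nat.reduceMul]
  simp [expW, expA, elt, mul_add, add_mul, mul_sub, sub_mul, mul_assoc,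
    show (v - (a / 2) • w) ∘ ν = v ∘ ν - (a / 2) • (w ∘ ν) from rfl, sub_dotProduct,
    dotProduct_sub, smul_dotProduct, dotProduct_smul, dotProduct_comp_comm hν w v]
  match_scalars <;> field_simp <;> ring

end BlockFrame

/-! ### The matrices of the first two columns -/

variable {Φ : OrthType} {m : ℕ} {F : Type*} [Field F]

/-- The matrix indices other than `±1` and `±2`, for `n = m + 2`. -/
abbrev Inner (Φ : OrthType) (m : ℕ) : Type := Fin m ⊕ Fin Φ.zeros ⊕ Fin m

/-- The inclusion of the indices other than `±1` and `±2` in all the matrix indices. The matrix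
indices `1` and `2` are `Idx.pos 0` and `Idx.pos 1`. -/
def Inner.emb : Inner Φ m → Idx Φ (m + 2)
  | .inl j => Idx.pos j.succ.succ
  | .inr (.inl z) => Idx.zero z
  | .inr (.inr j) => Idx.neg j.succ.succ

lemma Inner.idx_cases (i : Idx Φ (m + 2)) : i = Idx.pos 0 ∨ i = Idx.pos 1 ∨ i = Idx.neg 0 ∨
    i = Idx.neg 1 ∨ ∃ k : Inner Φ m, i = k.emb := by
  rcases i with (i | z | i)
  · induction i using Fin.cases with
    | zero => exact Or.inl rfl
    | succ i =>
      induction i using Fin.cases with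
      | zero => exact Or.inr (Or.inl rfl)
      | succ i => exact Or.inr (Or.inr (Or.inr (Or.inr ⟨.inl i, rfl⟩)))
  · exact Or.inr (Or.inr (Or.inr (Or.inr ⟨.inr (.inl z), rfl⟩)))
  · induction i using Fin.cases with
    | zero => exact Or.inr (Or.inr (Or.inl rfl))
    | succ i =>
      induction i using Fin.cases with
      | zero => exact Or.inr (Or.inr (Or.inr (Or.inl rfl)))
      | succ i => exact Or.inr (Or.inr (Or.inr (Or.inr ⟨.inr (.inr i), rfl⟩)))

lemma Inner.emb_injective : Function.Injective (Inner.emb : Inner Φ m → Idx Φ (m + 2)) := by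
  rintro (j | z | j) (j' | z' | j') h <;> simp_all [Inner.emb]

@[simp] lemma Inner.emb_ne_pos_zero (k : Inner Φ m) : k.emb ≠ Idx.pos 0 := by
  rcases k with (j | z | j) <;> simp [Inner.emb, Fin.ext_iff]

@[simp] lemma Inner.emb_ne_pos_one (k : Inner Φ m) : k.emb ≠ Idx.pos 1 := by
  rcases k with (j | z | j) <;> simp [Inner.emb, Fin.ext_iff]

@[simp] lemma Inner.emb_ne_neg_zero (k : Inner Φ m) : k.emb ≠ Idx.neg 0 := by
  rcases k with (j | z | j) <;> simp [Inner.emb, Fin.ext_iff]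

@[simp] lemma Inner.emb_ne_neg_one (k : Inner Φ m) : k.emb ≠ Idx.neg 1 := by
  rcases k with (j | z | j) <;> simp [Inner.emb, Fin.ext_iff]

/-- The change of sign of an index. -/
def Inner.flip : Inner Φ m → Inner Φ m
  | .inl j => .inr (.inr j)
  | .inr (.inl z) => .inr (.inl z)
  | .inr (.inr j) => .inl j

lemma Inner.flip_involutive : Function.Involutive (Inner.flip : Inner Φ m → Inner Φ m) := by
  rintro (j | z | j) <;> rfl

/-- Extension by zero from the indices other than `±1` and `±2` to all the matrix indices. -/
def extendZero : (Inner Φ m → F) →ₗ[F] (Idx Φ (m + 2) → F) where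
  toFun v
    | .inl i => Fin.cases 0 (Fin.cases 0 fun j => v (.inl j)) i
    | .inr (.inl z) => v (.inr (.inl z))
    | .inr (.inr i) => Fin.cases 0 (Fin.cases 0 fun j => v (.inr (.inr j))) i
  map_add' v w := by
    ext i
    obtain rfl | rfl | rfl | rfl | ⟨k, rfl⟩ := Inner.idx_cases i
    any_goals exact (add_zero (0 : F)).symm
    rcases k with (j | z | j) <;> rfl
  map_smul' c v := by
    ext i
    obtain rfl | rfl | rfl | rfl | ⟨k, rfl⟩ := Inner.idx_cases i
    any_goals exact (mul_zero c).symm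
    rcases k with (j | z | j) <;> rfl

@[simp] lemma extendZero_pos_zero (v : Inner Φ m → F) : extendZero v (Idx.pos 0) = 0 := rfl
@[simp] lemma extendZero_pos_one (v : Inner Φ m → F) : extendZero v (Idx.pos 1) = 0 := rfl
@[simp] lemma extendZero_neg_zero (v : Inner Φ m → F) : extendZero v (Idx.neg 0) = 0 := rfl
@[simp] lemma extendZero_neg_one (v : Inner Φ m → F) : extendZero v (Idx.neg 1) = 0 := rfl
@[simp] lemma extendZero_emb (v : Inner Φ m → F) (k : Inner Φ m) :
    extendZero v k.emb = v k := by
  rcases k with (j | z | j) <;> rfl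

lemma extendZero_dotProduct (v w : Inner Φ m → F) :
    extendZero v ⬝ᵥ extendZero w = v ⬝ᵥ w := by
  simp [dotProduct, Fintype.sum_sum_type, Fin.sum_univ_succ, extendZero]

lemma extendZero_single (k : Inner Φ m) :
    extendZero (Pi.single k (1 : F)) = Pi.single k.emb 1 := by
  ext i
  obtain rfl | rfl | rfl | rfl | ⟨l, rfl⟩ := Inner.idx_cases i
  any_goals simp [Pi.single_apply, Inner.emb_injective.eq_iff, eq_comm (b := k.emb)]

/-- The matrices `e_{1,2}`, `e_{-2,-1}`, `e_{2,-2}`, `∑ v_j e_{2,j}` and `∑ v_j e_{-j,-2}`. They are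
written as products of a column and a row vector, which makes their products scalar products. -/
def matrixFrame (Φ : OrthType) (m : ℕ) (F : Type*) [Field F] :
    BlockFrame F (Inner Φ m) (Matrix (Idx Φ (m + 2)) (Idx Φ (m + 2)) F) Inner.flip where
  e := Matrix.vecMulVec (Pi.single (Idx.pos 0) 1) (Pi.single (Idx.pos 1) 1)
  f := Matrix.vecMulVec (Pi.single (Idx.neg 1) 1) (Pi.single (Idx.neg 0) 1)
  s := Matrix.vecMulVec (Pi.single (Idx.pos 1) 1) (Pi.single (Idx.neg 1) 1)
  r :=
    { toFun v := Matrix.vecMulVec (Pi.single (Idx.pos 1) 1) (extendZero v)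
      map_add' v w := by rw [map_add, Matrix.vecMulVec_add]
      map_smul' c v := by rw [map_smul, Matrix.vecMulVec_smul, RingHom.id_apply] }
  k :=
    { toFun v := Matrix.vecMulVec (extendZero (v ∘ Inner.flip)) (Pi.single (Idx.neg 1) 1)
      map_add' v w := by
        rw [← Matrix.add_vecMulVec, ← map_add]
        rfl
      map_smul' c v := by
        rw [RingHom.id_apply, ← Matrix.smul_vecMulVec, ← map_smul]
        rfl }
  ee := by simp [Matrix.vecMulVec_mul_vecMulVec]
  ef := by simp [Matrix.vecMulVec_mul_vecMulVec]
  ek v := by simp [Matrix.vecMulVec_mul_vecMulVec]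
  fe := by simp [Matrix.vecMulVec_mul_vecMulVec]
  ff := by simp [Matrix.vecMulVec_mul_vecMulVec]
  fs := by simp [Matrix.vecMulVec_mul_vecMulVec]
  fr v := by simp [Matrix.vecMulVec_mul_vecMulVec]
  fk v := by simp [Matrix.vecMulVec_mul_vecMulVec]
  se := by simp [Matrix.vecMulVec_mul_vecMulVec]
  ss := by simp [Matrix.vecMulVec_mul_vecMulVec]
  sr v := by simp [Matrix.vecMulVec_mul_vecMulVec]
  sk v := by simp [Matrix.vecMulVec_mul_vecMulVec]
  re v := by simp [Matrix.vecMulVec_mul_vecMulVec]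
  rf v := by simp [Matrix.vecMulVec_mul_vecMulVec]
  rs v := by simp [Matrix.vecMulVec_mul_vecMulVec]
  rr v w := by simp [Matrix.vecMulVec_mul_vecMulVec]
  ke v := by simp [Matrix.vecMulVec_mul_vecMulVec]
  ks v := by simp [Matrix.vecMulVec_mul_vecMulVec]
  kr v w := by simp [Matrix.vecMulVec_mul_vecMulVec]
  kk v w := by simp [Matrix.vecMulVec_mul_vecMulVec]
  rk v w := by simp [Matrix.vecMulVec_mul_vecMulVec, extendZero_dotProduct]

lemma matrixFrame_e : (matrixFrame Φ m F).e = Matrix.single (Idx.pos 0) (Idx.pos 1) 1 :=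
  (Matrix.single_eq_single_vecMulVec_single _ _).symm

lemma matrixFrame_f : (matrixFrame Φ m F).f = Matrix.single (Idx.neg 1) (Idx.neg 0) 1 :=
  (Matrix.single_eq_single_vecMulVec_single _ _).symm

lemma matrixFrame_s : (matrixFrame Φ m F).s = Matrix.single (Idx.pos 1) (Idx.neg 1) 1 :=
  (Matrix.single_eq_single_vecMulVec_single _ _).symm

lemma matrixFrame_r (v : Inner Φ m → F) : (matrixFrame Φ m F).r v =
    Matrix.vecMulVec (Pi.single (Idx.pos 1) 1) (extendZero v) := rfl

lemma matrixFrame_k (v : Inner Φ m → F) : (matrixFrame Φ m F).k v =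
    Matrix.vecMulVec (extendZero (v ∘ Inner.flip)) (Pi.single (Idx.neg 1) 1) := rfl

lemma matrixFrame_r_single (k : Inner Φ m) : (matrixFrame Φ m F).r (Pi.single k 1) =
    Matrix.single (Idx.pos 1) k.emb 1 := by
  rw [matrixFrame_r, extendZero_single, Matrix.single_eq_single_vecMulVec_single]

lemma matrixFrame_k_single (k : Inner Φ m) : (matrixFrame Φ m F).k (Pi.single k 1) =
    Matrix.single k.flip.emb (Idx.neg 1) 1 := by
  have : (Pi.single k (1 : F) : Inner Φ m → F) ∘ Inner.flip = Pi.single k.flip 1 := by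
    ext i
    simp [Pi.single_apply, Inner.flip_involutive.eq_iff]
  rw [matrixFrame_k, this, extendZero_single, Matrix.single_eq_single_vecMulVec_single]

/-- The parametrization of `hei₂(Φ)` by the coordinates on the root vectors. -/
def heiCoord (Φ : OrthType) (m : ℕ) (F : Type*) [Field F] :
    ((F × F × (Inner Φ m → F)) × (Inner Φ m → F)) →ₗ[F]
      Matrix (Idx Φ (m + 2)) (Idx Φ (m + 2)) F where
  toFun x := (matrixFrame Φ m F).elt x.1 x.2
  map_add' x y := by
    simp only [BlockFrame.elt, Prod.fst_add, Prod.snd_add, map_add, mul_add, add_mul]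
    module
  map_smul' c x := by
    simp only [BlockFrame.elt, Prod.smul_fst, Prod.smul_snd, map_smul, mul_smul_comm,
      smul_mul_assoc, RingHom.id_apply, smul_eq_mul]
    module

lemma heiCoord_apply (x : (F × F × (Inner Φ m → F)) × (Inner Φ m → F)) :
    heiCoord Φ m F x = (matrixFrame Φ m F).elt x.1 x.2 := rfl

lemma heiCoord_sub_one : heiCoord Φ m F ((1, 0, 0), 0) =
    (PosRoot.sub 0 1 Fin.zero_lt_one).vec F := by
  simp [heiCoord_apply, BlockFrame.elt, matrixFrame_e, matrixFrame_f, PosRoot.vec]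

lemma heiCoord_add_one : heiCoord Φ m F ((0, 1, 0), 0) =
    (PosRoot.add 0 1 Fin.zero_lt_one).vec F := by
  simp [heiCoord_apply, BlockFrame.elt, matrixFrame_e, matrixFrame_f, matrixFrame_s, PosRoot.vec]

/-- The root of column `i`, for `i` the first or the second, that corresponds to the index `k`:
`ε_i - ε_j` for `k = j`, `ε_i` for `k = 0`, `ε_i + ε_j` for `k = -j`. -/
def innerRoot (i : Fin 2) : Inner Φ m → PosRoot Φ (m + 2)
  | .inl j => .sub (i.castLE (Nat.le_add_left 2 m)) j.succ.succ (by simp [Fin.lt_def]; omega)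
  | .inr (.inl z) => .short z (i.castLE (Nat.le_add_left 2 m))
  | .inr (.inr j) => .add (i.castLE (Nat.le_add_left 2 m)) j.succ.succ (by simp [Fin.lt_def]; omega)

lemma innerRoot_vec (i : Fin 2) (k : Inner Φ m) : (innerRoot i k).vec F =
    Matrix.single (Idx.pos (i.castLE (Nat.le_add_left 2 m))) k.emb 1 -
      Matrix.single k.flip.emb (Idx.neg (i.castLE (Nat.le_add_left 2 m))) 1 := by
  rcases k with (j | z | j) <;> rfl

lemma heiCoord_first (k : Inner Φ m) : heiCoord Φ m F ((0, 0, Pi.single k 1), 0) =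
    (innerRoot 0 k).vec F := by
  simp [heiCoord_apply, BlockFrame.elt, matrixFrame_e, matrixFrame_f, matrixFrame_r_single,
    matrixFrame_k_single, innerRoot_vec]

lemma heiCoord_second (k : Inner Φ m) : heiCoord Φ m F ((0, 0, 0), Pi.single k 1) =
    (innerRoot 1 k).vec F := by
  simp [heiCoord_apply, BlockFrame.elt, matrixFrame_r_single, matrixFrame_k_single, innerRoot_vec]
  rfl

lemma innerRoot_col (i : Fin 2) (k : Inner Φ m) : ((innerRoot i k).col : ℕ) = i := by
  rcases k with (j | z | j) <;> rfl

/-- The roots of the first two columns. -/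
lemma exists_innerRoot_eq (α : PosRoot Φ (m + 2)) (h : α.col.val = 0 ∨ α.col.val = 1) :
    α = .sub 0 1 Fin.zero_lt_one ∨ α = .add 0 1 Fin.zero_lt_one ∨ ∃ i k, α = innerRoot i k := by
  have hcol (i j : Fin (m + 2)) (hij : i < j) (hi : i.val = 0 ∨ i.val = 1) :
      (i = 0 ∧ j = 1) ∨ ∃ (i' : Fin 2) (j' : Fin m), i = i'.castLE (Nat.le_add_left 2 m) ∧
        j = j'.succ.succ := by
    by_cases hj : j.val ≤ 1
    · have := Fin.lt_def.1 hij
      refine Or.inl ⟨Fin.ext ?_, Fin.ext ?_⟩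
      · rw [Fin.val_zero]
        omega
      · rw [Fin.val_one]
        omega
    · refine Or.inr ⟨⟨i, by omega⟩, ⟨j - 2, by omega⟩, Fin.ext rfl, Fin.ext ?_⟩
      simp
      omega
  cases α with
  | sub i j hij =>
    obtain ⟨rfl, rfl⟩ | ⟨i, j, rfl, rfl⟩ := hcol i j hij h
    · exact Or.inl rfl
    · exact Or.inr (Or.inr ⟨i, .inl j, rfl⟩)
  | add i j hij =>
    obtain ⟨rfl, rfl⟩ | ⟨i, j, rfl, rfl⟩ := hcol i j hij h
    · exact Or.inr (Or.inl rfl)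
    · exact Or.inr (Or.inr ⟨i, .inr (.inr j), rfl⟩)
  | short z i =>
    refine Or.inr (Or.inr ⟨⟨i, ?_⟩, .inr (.inl z), rfl⟩)
    change i.val = 0 ∨ i.val = 1 at h
    omega

lemma heiAlg_eq_range : heiAlg Φ (m + 2) F = LinearMap.range (heiCoord Φ m F) := by
  refine le_antisymm (Submodule.span_le.2 ?_) ?_
  · rintro _ ⟨α, hα, rfl⟩
    obtain rfl | rfl | ⟨i, k, rfl⟩ := exists_innerRoot_eq α hα
    · exact ⟨_, heiCoord_sub_one⟩
    · exact ⟨_, heiCoord_add_one⟩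
    · fin_cases i
      · exact ⟨_, heiCoord_first k⟩
      · exact ⟨_, heiCoord_second k⟩
  · rintro _ ⟨⟨⟨a, c, v⟩, w⟩, rfl⟩
    have hvec (α : PosRoot Φ (m + 2)) (h : α.col.val = 0 ∨ α.col.val = 1) :
        α.vec F ∈ heiAlg Φ (m + 2) F := Submodule.subset_span ⟨α, h, rfl⟩
    have h : (((a, c, v), w) : (F × F × (Inner Φ m → F)) × (Inner Φ m → F)) =
        a • ((1, 0, 0), 0) + c • ((0, 1, 0), 0) +
        ∑ k, v k • ((0, 0, Pi.single k 1), 0) + ∑ k, w k • ((0, 0, 0), Pi.single k 1) := by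
      have hsum (u : Inner Φ m → F) : ∑ k, u k • Pi.single k (1 : F) = u := by
        ext i
        simp [Finset.sum_apply, Pi.single_apply]
      refine Prod.ext (Prod.ext ?_ (Prod.ext ?_ ?_)) ?_ <;>
        simp [Prod.fst_sum, Prod.snd_sum, hsum, -Fintype.sum_sum_type]
    rw [h]
    simp only [map_add, map_sum, map_smul, heiCoord_sub_one, heiCoord_add_one, heiCoord_first,
      heiCoord_second]
    refine add_mem (add_mem (add_mem ?_ ?_) ?_) ?_
    · exact Submodule.smul_mem _ _ (hvec _ (Or.inl rfl))
    · exact Submodule.smul_mem _ _ (hvec _ (Or.inl rfl))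
    · exact Submodule.sum_mem _ fun k _ =>
        Submodule.smul_mem _ _ (hvec _ (Or.inl (innerRoot_col 0 k)))
    · exact Submodule.sum_mem _ fun k _ =>
        Submodule.smul_mem _ _ (hvec _ (Or.inr (innerRoot_col 1 k)))

/-! ### The group as a semidirect product -/

/-- The general element of the group: the exponential of an element of the span of the first
column, times that of an element of the span of the second one. -/
def heiMatrix (x : (F × F × (Inner Φ m → F)) × (Inner Φ m → F)) :
    Matrix (Idx Φ (m + 2)) (Idx Φ (m + 2)) F :=
  (matrixFrame Φ m F).expA x.1 * (matrixFrame Φ m F).expW x.2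

lemma matrixFrame_e_mul_r (v : Inner Φ m → F) :
    (matrixFrame Φ m F).e * (matrixFrame Φ m F).r v =
      Matrix.vecMulVec (Pi.single (Idx.pos 0) 1) (extendZero v) := by
  simp [matrixFrame, Matrix.vecMulVec_mul_vecMulVec]

lemma matrixFrame_k_mul_f (v : Inner Φ m → F) :
    (matrixFrame Φ m F).k v * (matrixFrame Φ m F).f =
      Matrix.vecMulVec (extendZero (v ∘ Inner.flip)) (Pi.single (Idx.neg 0) 1) := by
  simp [matrixFrame, Matrix.vecMulVec_mul_vecMulVec]

/-- The coordinates of an element of the group can be read off in its first two rows. -/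
lemma heiMatrix_injective :
    Function.Injective (heiMatrix : (F × F × (Inner Φ m → F)) × (Inner Φ m → F) → _) := by
  have hentry (a c : F) (v w : Inner Φ m → F) (i j : Idx Φ (m + 2)) :=
    congrFun (congrFun ((matrixFrame Φ m F).expA_mul_expW a c v w) i) j
  simp only [matrixFrame_e_mul_r, matrixFrame_k_mul_f] at hentry
  simp only [matrixFrame_r, matrixFrame_k, matrixFrame_e, matrixFrame_f, matrixFrame_s,
    Matrix.single_mul_single_same, mul_one,
    Matrix.add_apply, Matrix.sub_apply, Matrix.smul_apply, Matrix.vecMulVec_apply] at hentry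
  rintro ⟨⟨a, c, v⟩, w⟩ ⟨⟨a', c', v'⟩, w'⟩ h
  have h' (i j : Idx Φ (m + 2)) := congrFun (congrFun h i) j
  simp only [heiMatrix, hentry] at h'
  have hne (k : Inner Φ m) : Idx.pos 0 ≠ k.emb ∧ Idx.pos 1 ≠ k.emb ∧ Idx.neg 0 ≠ k.emb ∧
      Idx.neg 1 ≠ k.emb := by
    simp [eq_comm (b := k.emb)]
  have hw : w = w' := by
    ext k
    simpa [Matrix.one_apply, Matrix.single_apply, hne] using h' (Idx.pos 1) k.emb
  have ha : a = a' := by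
    simpa [Matrix.one_apply, Matrix.single_apply] using h' (Idx.pos 0) (Idx.pos 1)
  subst hw ha
  have hv : v = v' := by
    ext k
    simpa [Matrix.one_apply, Matrix.single_apply, hne] using h' (Idx.pos 0) k.emb
  subst hv
  have hc : c = c' := by
    simpa [Matrix.one_apply, Matrix.single_apply] using h' (Idx.pos 0) (Idx.neg 1)
  rw [hc]

section

variable (h2 : (2 : F) ≠ 0)

include h2 in
lemma heiMatrix_mul (x y : F × F × (Inner Φ m → F)) (w w' : Inner Φ m → F) :
    heiMatrix (x, w) * heiMatrix (y, w') = heiMatrix (x + heiAct Inner.flip w y, w + w') := by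
  have hν := Inner.flip_involutive (Φ := Φ) (m := m)
  simp only [heiMatrix]
  rw [mul_assoc, ← mul_assoc _ (BlockFrame.expA _ y), BlockFrame.expW_mul_expA _ hν h2, mul_assoc,
    BlockFrame.expW_mul_expW _ hν h2, ← mul_assoc, BlockFrame.expA_mul_expA _ hν h2]

lemma heiMatrix_zero : heiMatrix (0 : (F × F × (Inner Φ m → F)) × (Inner Φ m → F)) = 1 := by
  rw [heiMatrix, Prod.fst_zero, Prod.snd_zero, BlockFrame.expA_zero, BlockFrame.expW_zero, one_mul]

/-- The coordinates of the inverse. -/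
def heiInv (x : (F × F × (Inner Φ m → F)) × (Inner Φ m → F)) :
    (F × F × (Inner Φ m → F)) × (Inner Φ m → F) :=
  (-heiAct Inner.flip (-x.2) x.1, -x.2)

include h2 in
lemma heiMatrix_mul_heiInv (x : (F × F × (Inner Φ m → F)) × (Inner Φ m → F)) :
    heiMatrix x * heiMatrix (heiInv x) = 1 := by
  obtain ⟨x, w⟩ := x
  have h : heiAct Inner.flip w (heiAct Inner.flip (-w) x) = x := by
    rw [← AddMonoidHom.comp_apply, ← heiAct_add Inner.flip_involutive h2, add_neg_cancel,
      heiAct_zero, AddMonoidHom.id_apply]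
  rw [heiInv, heiMatrix_mul h2, ← heiMatrix_zero]
  simp only [map_neg, h, add_neg_cancel]
  rfl

include h2 in
lemma heiInv_mul_heiMatrix (x : (F × F × (Inner Φ m → F)) × (Inner Φ m → F)) :
    heiMatrix (heiInv x) * heiMatrix x = 1 := by
  obtain ⟨x, w⟩ := x
  rw [heiInv, heiMatrix_mul h2, ← heiMatrix_zero]
  simp only [neg_add_cancel]
  rfl

/-- The element of the general linear group with matrix `heiMatrix x`. -/
def heiUnit (x : (F × F × (Inner Φ m → F)) × (Inner Φ m → F)) :
    Matrix.GeneralLinearGroup (Idx Φ (m + 2)) F :=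
  ⟨heiMatrix x, heiMatrix (heiInv x), heiMatrix_mul_heiInv h2 x, heiInv_mul_heiMatrix h2 x⟩

variable (h3 : (3 : F) ≠ 0)

include h2 h3 in
lemma nilExp_heiCoord (a c : F) (v w : Inner Φ m → F) :
    nilExp (heiCoord Φ m F ((a, c, v), w)) = heiMatrix ((a, c + v ⬝ᵥ (w ∘ Inner.flip) / 2 -
      a * (w ⬝ᵥ (w ∘ Inner.flip)) / 6, v - (a / 2) • w), w) := by
  have hν := Inner.flip_involutive (Φ := Φ) (m := m)
  rw [heiCoord_apply, nilExp_eq_sum_range (BlockFrame.elt_pow_five _ hν _ _),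
    BlockFrame.sum_elt_pow _ hν h2 h3]
  rfl

include h3 in
lemma heiUnit_mem_heiGroup (x : (F × F × (Inner Φ m → F)) × (Inner Φ m → F)) :
    heiUnit h2 x ∈ heiGroup Φ (m + 2) F := by
  obtain ⟨⟨a, c, v⟩, w⟩ := x
  have hexp (y) : heiCoord Φ m F y ∈ heiAlg Φ (m + 2) F := by
    rw [heiAlg_eq_range]
    exact ⟨y, rfl⟩
  have hA : heiUnit h2 ((a, c, v), 0) ∈ heiGroup Φ (m + 2) F := by
    refine Subgroup.subset_closure ⟨_, hexp ((a, c, v), 0), ?_⟩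
    rw [nilExp_heiCoord h2 h3]
    simp [heiUnit, show (0 : Inner Φ m → F) ∘ Inner.flip = 0 from rfl]
  have hW : heiUnit h2 ((0, 0, 0), w) ∈ heiGroup Φ (m + 2) F := by
    refine Subgroup.subset_closure ⟨_, hexp ((0, 0, 0), w), ?_⟩
    rw [nilExp_heiCoord h2 h3]
    simp [heiUnit]
  have h : heiUnit h2 ((a, c, v), w) = heiUnit h2 ((a, c, v), 0) * heiUnit h2 ((0, 0, 0), w) := by
    refine Units.ext ?_
    simp only [heiUnit, Units.val_mul, heiMatrix_mul h2]
    simp [heiAct_apply]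
  rw [h]
  exact mul_mem hA hW

include h3 in
lemma exists_heiUnit_eq {g : Matrix.GeneralLinearGroup (Idx Φ (m + 2)) F}
    (hg : g ∈ heiGroup Φ (m + 2) F) : ∃ x, heiUnit h2 x = g := by
  induction hg using Subgroup.closure_induction with
  | mem g hg =>
    obtain ⟨X, hX, hgX⟩ := hg
    rw [heiAlg_eq_range] at hX
    obtain ⟨⟨⟨a, c, v⟩, w⟩, rfl⟩ := hX
    rw [nilExp_heiCoord h2 h3] at hgX
    exact ⟨_, Units.ext hgX.symm⟩
  | one => exact ⟨0, Units.ext heiMatrix_zero⟩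
  | mul g g' _ _ hx hy =>
    obtain ⟨⟨x, w⟩, rfl⟩ := hx
    obtain ⟨⟨y, w'⟩, rfl⟩ := hy
    exact ⟨_, Units.ext (heiMatrix_mul h2 x y w w').symm⟩
  | inv g _ hx =>
    obtain ⟨x, rfl⟩ := hx
    exact ⟨heiInv x, Units.ext rfl⟩

include h2 h3 in
/-- The group `Hei₂` is the semidirect product of the exponentials of the spans of the first and of
the second column. -/
theorem exists_splitting :
    ∃ s : AbelianSplitting (heiGroup Φ (m + 2) F) (F × F × (Inner Φ m → F)) (Inner Φ m → F),
      s.act = heiAct Inner.flip :=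
  ⟨{  toEquiv := Equiv.ofBijective (fun x => ⟨heiUnit h2 x, heiUnit_mem_heiGroup h2 h3 x⟩)
        ⟨fun _ _ h => heiMatrix_injective (congrArg (fun g => g.1.1) h), fun g =>
          (exists_heiUnit_eq h2 h3 g.2).imp fun _ hx => Subtype.ext hx⟩
      act := heiAct Inner.flip
      act_zero := heiAct_zero _
      act_add := heiAct_add Inner.flip_involutive h2
      map_mul := fun x w y w' => Subtype.ext (Units.ext (heiMatrix_mul h2 x y w w')) }, rfl⟩

end

end OrthHei

theorem theorem5p2 (Φ : OrthHei.OrthType) (n : ℕ) (hn : 2 ≤ n) :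
    ∃ P : ℕ → Polynomial ℕ, ∀ (F : Type*) [Field F] [Finite F], 3 < ringChar F →
      (∀ χ ∈ OrthHei.irrChar (OrthHei.heiGroup Φ n F), ∃ e : ℕ, χ 1 = (Nat.card F : ℂ) ^ e) ∧
      ∀ e : ℕ,
        {χ ∈ OrthHei.irrChar (OrthHei.heiGroup Φ n F) | χ 1 = (Nat.card F : ℂ) ^ e}.encard =
          (((P e).eval (Nat.card F - 1) : ℕ) : ℕ∞) := by
  obtain ⟨m, rfl⟩ := Nat.exists_eq_add_of_le' hn
  refine ⟨OrthHei.charCount (Fintype.card (OrthHei.Inner Φ m)), fun F _ _ hF => ?_⟩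
  have hne {k : ℕ} (hk : 0 < k) (hk3 : k ≤ 3) : (k : F) ≠ 0 := fun h =>
    absurd (Nat.le_of_dvd hk ((ringChar.spec F k).1 h)) (by omega)
  have h2 : (2 : F) ≠ 0 := hne (k := 2) two_pos (by omega)
  have h3 : (3 : F) ≠ 0 := hne (k := 3) three_pos le_rfl
  obtain ⟨s, hs⟩ := OrthHei.exists_splitting (Φ := Φ) (m := m) h2 h3
  exact OrthHei.irrChar_degrees s OrthHei.Inner.flip_involutive hs
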